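/- Let $B$ be a Bratteli diagram: finite non-empty vertex sets $\mathscr V_0,\mathscr V_1,\dots$ with $|\mathscr V_0|=1$, and finite edge sets $\mathscr E_n$ ($n\ge 1$) with source map $s:\mathscr E_n\to\mathscr V_{n-1}$ and range map $r:\mathscr E_n\to\mathscr V_n$, both surjective. Its path space $X$ is the set of infinite paths $x=(x_n)_{n\ge1}$, $x_n\in\mathscr E_n$, $r(x_n)=s(x_{n+1})$, with the topology inherited from the product of the discrete spaces $\mathscr E_n$; assume that $X$ is homeomorphic to the Cantor set. An ordering $\xi$ is a choice, for every vertex $w$ at a level $\ge 1$, of a linear order on the set $r^{-1}(w)$ of edges entering $w$. For paths $x,y$ write $x<y$ if they agree from some level on and, at the last level where they differ, the edge of $x$ precedes that of $y$. The adic transformation $T_\xi$ sends each path that has a non-maximal edge to the smallest path larger than it. The ordering is proper if there is exactly one path with all edges maximal and exactly one with all edges minimal; then $T_\xi$ is extended to $X$ by sending the maximal path to the minimal one. An odometer is a topological dynamical system topologically conjugate to the extended adic system of an ordered diagram with exactly one vertex at every level and path space a Cantor set. Level $n\ge1$ is uniformly ordered by $\xi$ if there is a string $v$ of vertices of $\mathscr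 V_{n-1}$ such that for every $w\in\mathscr V_n$ the sequence of sources of the edges entering $w$, listed in increasing order, is a power $v^{k_w}$ of $v$. Let $\mu_0$ be the uniform independent measure on orderings: the product over all vertices $w$ at levels $\ge1$ of the uniform measures on the finite sets of linear orders of $r^{-1}(w)$. Suppose that for every $n\ge1$ the number of edges between $v$ and $w$ is the same number $m_n$ for all $v\in\mathscr V_{n-1}$, $w\in\mathscr V_n$. Put $V_n=|\mathscr V_n|$ and let $r_n=m_nV_{n-1}$ be the number of edges entering each vertex of level $n$. If $$\sum_{n=1}^\infty \frac{r_n!}{(r_n!)^{V_n}}=\infty ,$$ then for $\mu_0$-almost every ordering $\xi$ there are infinitely many levels uniformly ordered by $\xi$, and the adic system of $\xi$ is topologically conjugate to an odometer; that is, $\xi$ is proper, $T_\xi$ extends to a homeomorphism of $X$ as above, and this homeomorphism is an odometer. In particular, the same conclusion holds whenever the sequences $(m_n)$ and $(V_n)$ are bounded. -/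

import Mathlib

open MeasureTheory Filter
open scoped ENNReal Nat

universe u

/-- A Bratteli diagram. `V n` is the (finite) set of vertices of level `n`; `E n` is the (finite)
set of edges with source in level `n` and range in level `n + 1`. Every vertex emits an edge,
every vertex below level `0` receives an edge, and level `0` consists of a single vertex. -/
structure BratteliDiagram where
  V : ℕ → Type u
  E : ℕ → Type u
  src : ∀ n, E n → V n
  rng : ∀ n, E n → V (n + 1)
  finite_V : ∀ n, Finite (V n)
  finite_E : ∀ n, Finite (E n)
  card_root : Nat.card (V 0) = 1
  src_surjective : ∀ n, Function.Surjective (src n)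
  rng_surjective : ∀ n, Function.Surjective (rng n)

namespace BratteliDiagram

variable (B : BratteliDiagram.{u})

instance (n : ℕ) : Finite (B.V n) := B.finite_V n

instance (n : ℕ) : Finite (B.E n) := B.finite_E n

/-- Edge sets are discrete. -/
instance (n : ℕ) : TopologicalSpace (B.E n) := ⊥

instance (n : ℕ) : DiscreteTopology (B.E n) := ⟨rfl⟩

/-- The space of infinite paths starting at the root, with the topology induced by the product of
the discrete topologies (two paths are close if they agree on a long initial segment). -/
abbrev PathSpace : Type u :=
  {x : ∀ n, B.E n // ∀ n, B.rng n (x n) = B.src (n + 1) (x (n + 1))}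

/-- The vertices at levels `≥ 1`. -/
abbrev LowerVertex : Type u := Σ n, B.V (n + 1)

/-- The set `r⁻¹(w)` of edges entering `w`. -/
abbrev InEdges (w : B.LowerVertex) : Type u := {e : B.E w.1 // B.rng w.1 e = w.2}

/-- The linear orders on the finite set `r⁻¹(w)` of edges entering `w`: such an order is the
same thing as the increasing numbering of the edges by `0, 1, …, |r⁻¹(w)| - 1`. -/
def EdgeOrder (w : B.LowerVertex) : Type u := B.InEdges w ≃ Fin (Nat.card (B.InEdges w))

instance (w : B.LowerVertex) : Finite (B.EdgeOrder w) :=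
  inferInstanceAs (Finite (B.InEdges w ≃ Fin (Nat.card (B.InEdges w))))

instance (w : B.LowerVertex) : Nonempty (B.EdgeOrder w) := ⟨Finite.equivFin (B.InEdges w)⟩

instance (w : B.LowerVertex) : MeasurableSpace (B.EdgeOrder w) := ⊤

instance (w : B.LowerVertex) : DiscreteMeasurableSpace (B.EdgeOrder w) := ⟨fun _ => trivial⟩

/-- An ordering of the diagram: a linear order on the edges entering each vertex. -/
abbrev EdgeOrdering : Type u := ∀ w : B.LowerVertex, B.EdgeOrder w

/-- The uniform and independent random ordering: the product over all vertices `w` of the uniform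
probability measures on the finite sets of linear orders of `r⁻¹(w)`. -/
noncomputable def uniformOrdering : Measure B.EdgeOrdering :=
  Measure.infinitePi fun w => ProbabilityTheory.uniformOn (Set.univ : Set (B.EdgeOrder w))

variable {B}

/-- `e < e'` for the ordering `ξ`: both edges enter the same vertex and `e` precedes `e'`. -/
def EdgeLt (ξ : B.EdgeOrdering) {n : ℕ} (e e' : B.E n) : Prop :=
  ∃ (w : B.V (n + 1)) (h : B.rng n e = w) (h' : B.rng n e' = w),
    (show B.InEdges ⟨n, w⟩ ≃ Fin (Nat.card (B.InEdges ⟨n, w⟩)) from ξ ⟨n, w⟩) ⟨e, h⟩ <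
      (show B.InEdges ⟨n, w⟩ ≃ Fin (Nat.card (B.InEdges ⟨n, w⟩)) from ξ ⟨n, w⟩) ⟨e', h'⟩

/-- The paths all of whose edges are maximal. -/
def maxPaths (ξ : B.EdgeOrdering) : Set B.PathSpace :=
  {x | ∀ n, ∀ e : B.E n, ¬ EdgeLt ξ (x.1 n) e}

/-- The paths all of whose edges are minimal. -/
def minPaths (ξ : B.EdgeOrdering) : Set B.PathSpace :=
  {x | ∀ n, ∀ e : B.E n, ¬ EdgeLt ξ e (x.1 n)}

/-- The partial order on paths: `x < y` if the two paths eventually coincide and, at the last level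
where they differ, the edge of `x` precedes the edge of `y`. -/
def PathLt (ξ : B.EdgeOrdering) (x y : B.PathSpace) : Prop :=
  ∃ n, (∀ k, n < k → x.1 k = y.1 k) ∧ EdgeLt ξ (x.1 n) (y.1 n)

/-- `y` is the smallest path that is larger than `x`, i.e. `y` is the image of `x` under the adic
transformation. -/
def IsAdicImage (ξ : B.EdgeOrdering) (x y : B.PathSpace) : Prop :=
  PathLt ξ x y ∧ ∀ z, PathLt ξ x z → z = y ∨ PathLt ξ y z

/-- The ordering is proper: there are exactly one maximal path and exactly one minimal path. -/
def IsProper (ξ : B.EdgeOrdering) : Prop :=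
  (∃! x, x ∈ maxPaths ξ) ∧ (∃! x, x ∈ minPaths ξ)

/-- The self-homeomorphism `T` of the path space extends the adic transformation (which is defined
off the maximal paths) and sends maximal paths to minimal paths. -/
def IsAdicHomeo (ξ : B.EdgeOrdering) (T : B.PathSpace ≃ₜ B.PathSpace) : Prop :=
  (∀ x, x ∉ maxPaths ξ → IsAdicImage ξ x (T x)) ∧ ∀ x, x ∈ maxPaths ξ → T x ∈ minPaths ξ

/-- The coding `c(w) = s(e₁) s(e₂) ⋯` of a vertex `w` by vertices of the previous level, where
`e₁ < e₂ < ⋯` are the edges entering `w`. -/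
noncomputable def coding (ξ : B.EdgeOrdering) (w : B.LowerVertex) : List (B.V w.1) :=
  List.ofFn fun i => B.src w.1
    ((show B.InEdges w ≃ Fin (Nat.card (B.InEdges w)) from ξ w).symm i).1

/-- Level `n + 1` is uniformly ordered: there is a string `v` of vertices of level `n` such that
the coding of every vertex of level `n + 1` is a power of `v`. -/
def IsUniformlyOrdered (ξ : B.EdgeOrdering) (n : ℕ) : Prop :=
  ∃ v : List (B.V n), ∀ w : B.V (n + 1), ∃ k : ℕ,
    coding ξ ⟨n, w⟩ = (List.replicate k v).flatten

end BratteliDiagram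

/-- `X` is homeomorphic to the Cantor set. -/
def IsCantorSet (X : Type u) [TopologicalSpace X] : Prop := Nonempty (X ≃ₜ (ℕ → Bool))

/-- The topological dynamical system `(X, T)` is an odometer: it is topologically conjugate to the
adic system on the path space (a Cantor set) of an ordered diagram having exactly one vertex at
every level. -/
def IsOdometer {X : Type u} [TopologicalSpace X] (T : X ≃ₜ X) : Prop :=
  ∃ (B : BratteliDiagram.{0}) (ξ : B.EdgeOrdering) (S : B.PathSpace ≃ₜ B.PathSpace)
    (h : X ≃ₜ B.PathSpace),
    (∀ n, Nat.card (B.V n) = 1) ∧ IsCantorSet B.PathSpace ∧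
      BratteliDiagram.IsAdicHomeo ξ S ∧ ∀ x, h (T x) = S (h x)

/-- The adic system of the ordered diagram `(B, ξ)` is topologically conjugate to an odometer: the
ordering is proper, the adic transformation extends to a homeomorphism of the path space (taking
the maximal path to the minimal path), and this homeomorphism is an odometer. -/
def BratteliDiagram.AdicConjugateToOdometer {B : BratteliDiagram.{u}} (ξ : B.EdgeOrdering) :
    Prop :=
  BratteliDiagram.IsProper ξ ∧
    ∃ T : B.PathSpace ≃ₜ B.PathSpace, BratteliDiagram.IsAdicHomeo ξ T ∧ IsOdometer T

/-! Number the edges entering each vertex by their positions. Call a level good if the source of an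
edge depends only on its position (`SrcByIdx`); then all vertices of that level have the same
coding, so the level is uniformly ordered.

Probability: since incidence numbers do not depend on the range, each order at one vertex can be
copied to the others compatibly with sources. A level is therefore good with probability at least
`r! / (r!) ^ V` (`le_levelUniform_srcByIdx`). Levels are independent, so the second Borel–Cantelli
lemma gives infinitely many good levels almost surely (`ae_frequently_srcByIdx`).

Dynamics: with infinitely many good levels, a path is determined by its sequence of positions
(`eq_of_idx_eq_of_frequently`), and compactness makes every sequence of positions occur
(`exists_path_idx_eq`). Reading positions is then a homeomorphism onto the path space of a
one-vertex diagram that preserves the path order, so it carries the adic map to addition of one with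
carry. -/

namespace BratteliDiagram

/-! ### Positions of edges and the paths they determine -/

section Index

variable {B : BratteliDiagram.{u}}

/-- A linear order on the edges entering `w`, as a numbering. -/
def EdgeOrder.toEquiv {w : B.LowerVertex} (o : B.EdgeOrder w) :
    B.InEdges w ≃ Fin (Nat.card (B.InEdges w)) := o

/-- The position of an edge among the edges with the same range, for an ordering of the edges
between two consecutive levels. -/
def levelIdx {n : ℕ} (g : ∀ w : B.V (n + 1), B.EdgeOrder ⟨n, w⟩) (e : B.E n) : ℕ :=
  ((g (B.rng n e)).toEquiv ⟨e, rfl⟩).val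

/-- The position of an edge among the edges with the same range. -/
def idx (ξ : B.EdgeOrdering) {n : ℕ} (e : B.E n) : ℕ :=
  levelIdx (fun w => ξ ⟨n, w⟩) e

theorem levelIdx_eq {n : ℕ} (g : ∀ w : B.V (n + 1), B.EdgeOrder ⟨n, w⟩) {e : B.E n}
    {w : B.V (n + 1)} (h : B.rng n e = w) :
    levelIdx g e = ((g w).toEquiv ⟨e, h⟩).val := by
  subst h; rfl

theorem idx_eq (ξ : B.EdgeOrdering) {n : ℕ} {e : B.E n} {w : B.V (n + 1)} (h : B.rng n e = w) :
    idx ξ e = ((ξ ⟨n, w⟩).toEquiv ⟨e, h⟩).val :=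
  levelIdx_eq _ h

theorem edgeLt_iff (ξ : B.EdgeOrdering) {n : ℕ} {e e' : B.E n} :
    EdgeLt ξ e e' ↔ B.rng n e = B.rng n e' ∧ idx ξ e < idx ξ e' := by
  constructor
  · rintro ⟨w, h, h', hlt⟩
    exact ⟨h.trans h'.symm, by rw [idx_eq ξ h, idx_eq ξ h']; exact hlt⟩
  · rintro ⟨h, hlt⟩
    rw [idx_eq ξ h, idx_eq ξ rfl] at hlt
    exact ⟨_, h, rfl, hlt⟩

theorem eq_of_idx_eq (ξ : B.EdgeOrdering) {n : ℕ} {e e' : B.E n}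
    (h : B.rng n e = B.rng n e') (hi : idx ξ e = idx ξ e') : e = e' := by
  rw [idx_eq ξ h, idx_eq ξ rfl] at hi
  exact congrArg Subtype.val ((ξ ⟨n, B.rng n e'⟩).toEquiv.injective (Fin.ext hi))

theorem idx_lt (ξ : B.EdgeOrdering) {n : ℕ} (e : B.E n) :
    idx ξ e < Nat.card {e' : B.E n // B.rng n e' = B.rng n e} :=
  ((ξ ⟨n, B.rng n e⟩).toEquiv ⟨e, rfl⟩).isLt

theorem exists_edge_idx_eq (ξ : B.EdgeOrdering) {n : ℕ} (w : B.V (n + 1)) {i : ℕ}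
    (hi : i < Nat.card {e : B.E n // B.rng n e = w}) :
    ∃ e, B.rng n e = w ∧ idx ξ e = i := by
  refine ⟨((ξ ⟨n, w⟩).toEquiv.symm ⟨i, hi⟩).1, ((ξ ⟨n, w⟩).toEquiv.symm ⟨i, hi⟩).2, ?_⟩
  rw [idx_eq ξ ((ξ ⟨n, w⟩).toEquiv.symm ⟨i, hi⟩).2]
  simp

theorem nonempty_V (B : BratteliDiagram.{u}) (n : ℕ) : Nonempty (B.V n) := by
  induction n with
  | zero => exact (Nat.card_pos_iff.1 (B.card_root.symm ▸ Nat.one_pos)).1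
  | succ n ih => exact ih.elim fun v => ⟨B.rng n (B.src_surjective n v).choose⟩

/-- Between levels `n` and `n + 1`, the source of an edge depends only on its position. -/
def SrcByIdx {n : ℕ} (g : ∀ w : B.V (n + 1), B.EdgeOrder ⟨n, w⟩) : Prop :=
  ∀ e e' : B.E n, levelIdx g e = levelIdx g e' → B.src n e = B.src n e'

/-- All vertices share one coding, so that coding serves as the string and every exponent is 1. -/
theorem SrcByIdx.isUniformlyOrdered {ξ : B.EdgeOrdering} {n k : ℕ}
    (hk : ∀ w : B.V (n + 1), Nat.card {e : B.E n // B.rng n e = w} = k)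
    (h : SrcByIdx fun w => ξ ⟨n, w⟩) : IsUniformlyOrdered ξ n := by
  obtain ⟨w₀⟩ := B.nonempty_V (n + 1)
  refine ⟨coding ξ ⟨n, w₀⟩, fun w => ⟨1, ?_⟩⟩
  simp only [List.replicate_one, List.flatten_singleton]
  have hk' : ∀ w : B.V (n + 1), Nat.card (B.InEdges ⟨n, w⟩) = k := hk
  apply List.ext_getElem
  · simp only [coding, List.length_ofFn]
    rw [hk', hk']
  · intro i h₁ h₂
    simp only [coding, List.getElem_ofFn]
    apply h
    have key : ∀ (w : B.V (n + 1)) (i : Fin (Nat.card (B.InEdges ⟨n, w⟩))),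
        levelIdx (fun w => ξ ⟨n, w⟩) ((ξ ⟨n, w⟩).toEquiv.symm i).1 = i := fun w i => by
      rw [levelIdx_eq _ ((ξ ⟨n, w⟩).toEquiv.symm i).2]
      simp
    exact (key w ⟨i, _⟩).trans (key w₀ ⟨i, _⟩).symm

theorem mem_maxPaths_iff {ξ : B.EdgeOrdering} {r : ℕ → ℕ}
    (hr : ∀ n (w : B.V (n + 1)), Nat.card {e : B.E n // B.rng n e = w} = r n)
    {x : B.PathSpace} : x ∈ maxPaths ξ ↔ ∀ n, idx ξ (x.1 n) + 1 = r n := by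
  refine forall_congr' fun n => ⟨fun h => ?_, fun h e => ?_⟩
  · by_contra hne
    have hlt := idx_lt ξ (x.1 n)
    rw [hr] at hlt
    obtain ⟨e, he, hi⟩ := exists_edge_idx_eq ξ (B.rng n (x.1 n)) (i := idx ξ (x.1 n) + 1)
      (by rw [hr]; omega)
    exact h e ((edgeLt_iff ξ).2 ⟨he.symm, by omega⟩)
  · rw [edgeLt_iff]
    have hlt := idx_lt ξ e
    rw [hr] at hlt
    omega

theorem mem_minPaths_iff {ξ : B.EdgeOrdering} {x : B.PathSpace} :
    x ∈ minPaths ξ ↔ ∀ n, idx ξ (x.1 n) = 0 := by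
  refine forall_congr' fun n => ⟨fun h => ?_, fun h e => ?_⟩
  · by_contra hne
    obtain ⟨e, he, hi⟩ := exists_edge_idx_eq ξ (B.rng n (x.1 n)) (i := 0)
      (Nat.zero_le _ |>.trans_lt (idx_lt ξ (x.1 n)))
    exact h e ((edgeLt_iff ξ).2 ⟨he, by omega⟩)
  · rw [edgeLt_iff]
    omega

/-- At a good level beyond `k`, equal positions force equal sources. Going back up towards the root,
a common source is a common range one level earlier; range and position determine the edge, hence
its source again. -/
theorem eq_of_idx_eq_of_frequently {ξ : B.EdgeOrdering}
    (hU : ∃ᶠ n in atTop, SrcByIdx fun w => ξ ⟨n, w⟩) {x y : B.PathSpace} {N : ℕ}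
    (h : ∀ k, N ≤ k → idx ξ (x.1 k) = idx ξ (y.1 k)) {k : ℕ} (hk : N ≤ k) : x.1 k = y.1 k := by
  obtain ⟨n, hn, hs⟩ := frequently_atTop.1 hU (k + 1)
  have key : ∀ j, j ≤ n → k ≤ j → B.src j (x.1 j) = B.src j (y.1 j) := by
    intro j hj
    induction hj using Nat.decreasingInduction with
    | self => exact fun hk' => hs _ _ (h n (by omega))
    | of_succ j hj ih =>
      intro hk'
      have : x.1 j = y.1 j := eq_of_idx_eq ξ (by rw [x.2, y.2, ih (by omega)]) (h j (by omega))
      rw [this]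
  exact eq_of_idx_eq ξ (by rw [x.2, y.2, key _ hn (by omega)]) (h k hk)

/-- Sending `w` to the source of its incoming edge at the prescribed position makes the vertex sets
an inverse system of nonempty finite sets. A point of its limit is the vertex sequence of the
required path. -/
theorem exists_path_idx_eq (ξ : B.EdgeOrdering) {i : ℕ → ℕ}
    (hi : ∀ n (w : B.V (n + 1)), i n < Nat.card {e : B.E n // B.rng n e = w}) :
    ∃ x : B.PathSpace, ∀ n, idx ξ (x.1 n) = i n := by
  choose e he hei using fun n (w : B.V (n + 1)) => exists_edge_idx_eq ξ w (hi n w)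
  let F : CategoryTheory.Functor ℕᵒᵖ (Type u) := CategoryTheory.Functor.ofOpSequence (X := B.V)
    fun n => TypeCat.ofHom (fun w : B.V (n + 1) => B.src n (e n w))
  have : ∀ j : ℕᵒᵖ, Finite (F.obj j) := fun j => B.finite_V _
  have : ∀ j : ℕᵒᵖ, Nonempty (F.obj j) := fun j => B.nonempty_V _
  obtain ⟨s, hs⟩ := nonempty_sections_of_finite_inverse_system F
  let v : ∀ n, B.V n := fun n => s (Opposite.op n)
  have hv : ∀ n, B.src n (e n (v (n + 1))) = v n := fun n => by
    have h := hs (CategoryTheory.homOfLE (Nat.le_add_right n 1)).op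
    rw [CategoryTheory.Functor.ofOpSequence_map_homOfLE_succ] at h
    exact h
  exact ⟨⟨fun n => e n (v (n + 1)), fun n => by rw [he, hv]⟩, fun n => hei _ _⟩

end Index

end BratteliDiagram

/-! ### Addition of one with carry -/

theorem Fin.add_one_eq_zero_iff_val {n : ℕ} [NeZero n] {a : Fin n} : a + 1 = 0 ↔ a.val + 1 = n := by
  have ha := a.isLt
  rw [Fin.ext_iff, Fin.val_add, Fin.val_one', Nat.add_mod_mod, Fin.val_zero]
  constructor
  · intro h
    by_contra hne
    rw [Nat.mod_eq_of_lt (by omega)] at h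
    omega
  · intro h
    rw [h, Nat.mod_self]

theorem Fin.val_add_one_of_add_one_ne_zero {n : ℕ} [NeZero n] {a : Fin n} (h : a + 1 ≠ 0) :
    (a + 1).val = a.val + 1 := by
  have ha := a.isLt
  rw [Ne, Fin.add_one_eq_zero_iff_val] at h
  rw [Fin.val_add, Fin.val_one', Nat.add_mod_mod, Nat.mod_eq_of_lt (by omega)]

section Carry

variable (r : ℕ → ℕ) [∀ n, NeZero (r n)]

/-- Addition of one with carry on a product of finite cyclic sets. -/
def carryEquiv : (∀ n, Fin (r n)) ≃ (∀ n, Fin (r n)) where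
  toFun x n := if ∀ k < n, x k + 1 = 0 then x n + 1 else x n
  invFun y n := if ∀ k < n, y k = 0 then y n - 1 else y n
  left_inv x := by
    funext n
    -- The image shows whether a carry reached digit `n`: its lower digits all vanish exactly when
    -- those of `x` were all maximal.
    have key : (∀ k < n, (if ∀ j < k, x j + 1 = 0 then x k + 1 else x k) = 0) ↔
        ∀ k < n, x k + 1 = 0 := by
      refine ⟨fun h k => ?_, fun h k hk => ?_⟩
      · induction k using Nat.strong_induction_on with
        | _ k ih =>
          intro hk
          have := h k hk
          rwa [if_pos fun j hj => ih j hj (hj.trans hk)] at this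
      · rw [if_pos fun j hj => h j (hj.trans hk), h k hk]
    simp only [key]
    split_ifs <;> simp
  right_inv y := by
    funext n
    have key : (∀ k < n, (if ∀ j < k, y j = 0 then y k - 1 else y k) + 1 = 0) ↔
        ∀ k < n, y k = 0 := by
      refine ⟨fun h k => ?_, fun h k hk => ?_⟩
      · induction k using Nat.strong_induction_on with
        | _ k ih =>
          intro hk
          have := h k hk
          rwa [if_pos fun j hj => ih j hj (hj.trans hk), sub_add_cancel] at this
      · rw [if_pos fun j hj => h j (hj.trans hk), sub_add_cancel, h k hk]
    simp only [key]
    split_ifs <;> simp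

variable {r}

theorem carryEquiv_apply_of_forall {x : ∀ n, Fin (r n)} {n : ℕ} (h : ∀ k < n, x k + 1 = 0) :
    carryEquiv r x n = x n + 1 := if_pos h

theorem carryEquiv_apply_of_lt {x : ∀ n, Fin (r n)} {k n : ℕ} (hk : x k + 1 ≠ 0) (h : k < n) :
    carryEquiv r x n = x n := if_neg fun h' => hk (h' k h)

/-- The carry condition involves finitely many digits, so it is clopen and the two branches need no
matching on a frontier. -/
theorem continuous_carryEquiv : Continuous (carryEquiv r) := by
  refine continuous_pi fun n => ?_
  have hc : IsClopen {x : ∀ n, Fin (r n) | ∀ k < n, x k + 1 = 0} := by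
    have : {x : ∀ n, Fin (r n) | ∀ k < n, x k + 1 = 0} =
        ⋂ k ∈ Set.Iio n, (fun x : ∀ n, Fin (r n) => x k) ⁻¹' {a | a + 1 = 0} := by
      ext x; simp
    rw [this]
    exact (Set.finite_Iio n).isClopen_biInter fun k _ =>
      (isClopen_discrete _).preimage (continuous_apply k)
  refine Continuous.if (p := fun x : ∀ n, Fin (r n) => ∀ k < n, x k + 1 = 0) ?_ ?_ ?_
  · intro a ha
    rw [hc.frontier_eq] at ha
    exact ha.elim
  · exact (continuous_of_discreteTopology (f := fun a : Fin (r n) => a + 1)).comp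
      (continuous_apply n)
  · exact continuous_apply n

end Carry

namespace BratteliDiagram

/-! ### The one-vertex diagram and its adic map -/

section Odometer

variable (r : ℕ → ℕ) [∀ n, NeZero (r n)]

/-- The diagram with one vertex at every level and `r n` edges from level `n` to level `n + 1`. -/
def odometerDiagram : BratteliDiagram.{0} where
  V _ := Unit
  E n := Fin (r n)
  src _ _ := ()
  rng _ _ := ()
  finite_V _ := inferInstance
  finite_E _ := inferInstance
  card_root := by simp
  src_surjective _ _ := ⟨(0 : Fin _), rfl⟩
  rng_surjective _ _ := ⟨(0 : Fin _), rfl⟩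

/-- All edges of an odometer diagram with given range. -/
def odometerInEdges (w : (odometerDiagram r).LowerVertex) :
    (odometerDiagram r).InEdges w ≃ Fin (r w.1) :=
  Equiv.subtypeUnivEquiv fun _ => rfl

theorem card_odometerInEdges (w : (odometerDiagram r).LowerVertex) :
    Nat.card ((odometerDiagram r).InEdges w) = r w.1 := by
  rw [Nat.card_congr (odometerInEdges r w), Nat.card_fin]

/-- The natural ordering of an odometer diagram. -/
noncomputable def odometerOrdering : (odometerDiagram r).EdgeOrdering := fun w =>
  (odometerInEdges r w).trans (finCongr (card_odometerInEdges r w).symm)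

/-- The digits of a path of an odometer diagram. -/
def odometerPathHomeo : (odometerDiagram r).PathSpace ≃ₜ (∀ n, Fin (r n)) where
  toFun x := x.1
  invFun x := ⟨x, fun _ => rfl⟩
  left_inv _ := rfl
  right_inv _ := rfl
  continuous_toFun := continuous_subtype_val
  continuous_invFun := Continuous.subtype_mk continuous_id _

variable {r}

theorem idx_odometerOrdering {n : ℕ} (x : (odometerDiagram r).PathSpace) :
    idx (odometerOrdering r) (x.1 n) = (odometerPathHomeo r x n).val := rfl

theorem pathLt_odometerOrdering {x y : (odometerDiagram r).PathSpace} :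
    PathLt (odometerOrdering r) x y ↔
      ∃ n, (∀ k, n < k → odometerPathHomeo r x k = odometerPathHomeo r y k) ∧
        odometerPathHomeo r x n < odometerPathHomeo r y n := by
  refine exists_congr fun n => and_congr Iff.rfl ?_
  rw [edgeLt_iff]
  exact and_iff_right rfl

theorem mem_maxPaths_odometerOrdering {x : (odometerDiagram r).PathSpace} :
    x ∈ maxPaths (odometerOrdering r) ↔ ∀ n, odometerPathHomeo r x n + 1 = 0 := by
  rw [mem_maxPaths_iff fun n w => card_odometerInEdges r ⟨n, w⟩]
  refine forall_congr' fun n => ?_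
  rw [idx_odometerOrdering, Fin.add_one_eq_zero_iff_val]

theorem mem_minPaths_odometerOrdering {x : (odometerDiagram r).PathSpace} :
    x ∈ minPaths (odometerOrdering r) ↔ ∀ n, odometerPathHomeo r x n = 0 := by
  rw [mem_minPaths_iff]
  exact forall_congr' fun n => (Fin.ext_iff (b := (0 : Fin (r n)))).symm

variable (r)

/-- Addition of one with carry on the path space of an odometer diagram. -/
noncomputable def odometerHomeo :
    (odometerDiagram r).PathSpace ≃ₜ (odometerDiagram r).PathSpace :=
  ((odometerPathHomeo r).trans
    (continuous_carryEquiv (r := r)).homeoOfEquivCompactToT2).trans (odometerPathHomeo r).symm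

variable {r}

theorem odometerPathHomeo_odometerHomeo (x : (odometerDiagram r).PathSpace) :
    odometerPathHomeo r (odometerHomeo r x) = carryEquiv r (odometerPathHomeo r x) := rfl

/-- With `k` the first non-maximal digit, the map increments digit `k` and resets the lower ones to
0, which is the least way to increase. -/
theorem isAdicImage_odometerHomeo {x : (odometerDiagram r).PathSpace}
    (hx : x ∉ maxPaths (odometerOrdering r)) :
    IsAdicImage (odometerOrdering r) x (odometerHomeo r x) := by
  classical
  rw [mem_maxPaths_odometerOrdering] at hx
  push Not at hx
  set a := odometerPathHomeo r x with ha
  obtain ⟨k, hk, hlow⟩ : ∃ k, a k + 1 ≠ 0 ∧ ∀ j < k, a j + 1 = 0 :=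
    ⟨Nat.find hx, Nat.find_spec hx, fun j hj => not_not.1 (Nat.find_min hx hj)⟩
  have hy_low : ∀ j < k, carryEquiv r a j = 0 := fun j hj => by
    rw [carryEquiv_apply_of_forall fun i hi => hlow i (hi.trans hj), hlow j hj]
  have hy_mid : (carryEquiv r a k).val = (a k).val + 1 := by
    rw [carryEquiv_apply_of_forall hlow, Fin.val_add_one_of_add_one_ne_zero hk]
  have hy_high : ∀ j, k < j → carryEquiv r a j = a j := fun j => carryEquiv_apply_of_lt hk
  refine ⟨pathLt_odometerOrdering.2 ⟨k, fun j hj => (hy_high j hj).symm, ?_⟩, fun z hz => ?_⟩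
  · rw [odometerPathHomeo_odometerHomeo, ← ha, Fin.lt_def]
    omega
  · obtain ⟨n, hn, hlt⟩ := pathLt_odometerOrdering.1 hz
    rw [pathLt_odometerOrdering, odometerPathHomeo_odometerHomeo,
      ← (odometerPathHomeo r).injective.eq_iff, odometerPathHomeo_odometerHomeo]
    rw [← ha] at hn hlt ⊢
    set c := odometerPathHomeo r z
    rw [Fin.lt_def] at hlt
    -- Below `k` the digits of `x` are maximal, so `z` cannot exceed `x` there.
    have hkn : k ≤ n := by
      by_contra hnk
      have h₁ := Fin.add_one_eq_zero_iff_val.1 (hlow n (by omega))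
      have h₂ := (c n).isLt
      omega
    rcases hkn.lt_or_eq with hkn | rfl
    · exact Or.inr ⟨n, fun j hj => (hy_high j (by omega)).trans (hn j hj),
        by rw [hy_high n hkn]; exact hlt⟩
    · rcases Nat.lt_or_ge (carryEquiv r a k).val (c k).val with hlt' | hge
      · exact Or.inr ⟨k, fun j hj => (hy_high j hj).trans (hn j hj), hlt'⟩
      · have heq : ∀ j, k ≤ j → carryEquiv r a j = c j := fun j hj => by
          rcases hj.lt_or_eq with hj | rfl
          · exact (hy_high j hj).trans (hn j hj)
          · exact Fin.ext (by omega)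
        -- From `k` on, `z` and the image agree. If they differ at all, the last difference lies
        -- below `k`, where the image has digit 0.
        by_cases hne : ∃ j, j ≤ k ∧ c j ≠ carryEquiv r a j
        · obtain ⟨i, hik, hi⟩ := hne
          have hmax := Nat.findGreatest_spec (P := fun j => c j ≠ carryEquiv r a j) hik hi
          have hle := Nat.findGreatest_le (P := fun j => c j ≠ carryEquiv r a j) k
          have hgt := fun j => Nat.findGreatest_is_greatest
            (P := fun j => c j ≠ carryEquiv r a j) (n := k) (k := j)
          set m := Nat.findGreatest (fun j => c j ≠ carryEquiv r a j) k
          refine Or.inr ⟨m, fun j hj => ?_, ?_⟩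
          · rcases Nat.lt_or_ge k j with h | h
            · exact heq j h.le
            · exact (not_not.1 (hgt j hj h)).symm
          · have hmk : m < k := lt_of_le_of_ne hle fun h => hmax (heq m h.ge).symm
            rw [hy_low m hmk] at hmax ⊢
            exact Fin.pos_iff_ne_zero.2 hmax
        · push Not at hne
          refine Or.inl (funext fun j => ?_)
          rcases Nat.lt_or_ge k j with h | h
          · exact (heq j h.le).symm
          · exact hne j h

theorem isAdicHomeo_odometerHomeo : IsAdicHomeo (odometerOrdering r) (odometerHomeo r) := by
  refine ⟨fun x hx => isAdicImage_odometerHomeo hx, fun x hx => ?_⟩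
  rw [mem_maxPaths_odometerOrdering] at hx
  rw [mem_minPaths_odometerOrdering]
  intro n
  rw [odometerPathHomeo_odometerHomeo, carryEquiv_apply_of_forall fun k _ => hx k, hx n]

theorem isProper_odometerOrdering : IsProper (odometerOrdering r) := by
  constructor
  · refine ⟨(odometerPathHomeo r).symm fun _ => -1, ?_, fun y hy => ?_⟩
    · simp only [mem_maxPaths_odometerOrdering, Homeomorph.apply_symm_apply]
      intro n
      rw [neg_add_cancel]
    · replace hy := mem_maxPaths_odometerOrdering.1 hy
      rw [← (odometerPathHomeo r).injective.eq_iff, Homeomorph.apply_symm_apply]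
      exact funext fun n => eq_neg_of_add_eq_zero_left (hy n)
  · refine ⟨(odometerPathHomeo r).symm fun _ => 0, ?_, fun y hy => ?_⟩
    · simp [mem_minPaths_odometerOrdering]
    · replace hy := mem_minPaths_odometerOrdering.1 hy
      rw [← (odometerPathHomeo r).injective.eq_iff, Homeomorph.apply_symm_apply]
      exact funext hy

end Odometer

end BratteliDiagram

namespace BratteliDiagram

/-! ### Conjugacy with the odometer by reading positions -/

section Conjugacy

variable {B : BratteliDiagram.{u}} {r : ℕ → ℕ} [∀ n, NeZero (r n)]

/-- The positions of the edges of a path, as a path of an odometer diagram. -/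
def idxPath (hr : ∀ n (w : B.V (n + 1)), Nat.card {e : B.E n // B.rng n e = w} = r n)
    (ξ : B.EdgeOrdering) (x : B.PathSpace) : (odometerDiagram r).PathSpace :=
  ⟨fun n => (⟨idx ξ (x.1 n), (idx_lt ξ (x.1 n)).trans_eq (hr _ _)⟩ : Fin (r n)), fun _ => rfl⟩

variable {hr : ∀ n (w : B.V (n + 1)), Nat.card {e : B.E n // B.rng n e = w} = r n}
  {ξ : B.EdgeOrdering}

theorem idx_idxPath (x : B.PathSpace) (n : ℕ) :
    idx (odometerOrdering r) ((idxPath hr ξ x).1 n) = idx ξ (x.1 n) := rfl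

theorem idxPath_apply_eq_iff {x y : B.PathSpace} {n : ℕ} :
    (idxPath hr ξ x).1 n = (idxPath hr ξ y).1 n ↔ idx ξ (x.1 n) = idx ξ (y.1 n) :=
  Fin.ext_iff

theorem continuous_idxPath : Continuous (idxPath hr ξ) := by
  refine Continuous.subtype_mk (continuous_pi fun n => ?_) _
  exact (continuous_of_discreteTopology (f := fun e : B.E n =>
    (⟨idx ξ e, (idx_lt ξ e).trans_eq (hr _ _)⟩ : Fin (r n)))).comp
      ((continuous_apply n).comp continuous_subtype_val)

theorem bijective_idxPath (hU : ∃ᶠ n in atTop, SrcByIdx fun w => ξ ⟨n, w⟩) :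
    Function.Bijective (idxPath hr ξ) := by
  refine ⟨fun x y h => Subtype.ext (funext fun n => ?_), fun y => ?_⟩
  · exact eq_of_idx_eq_of_frequently hU (N := 0)
      (fun k _ => idxPath_apply_eq_iff.1 (congrFun (congrArg Subtype.val h) k)) n.zero_le
  · obtain ⟨x, hx⟩ := exists_path_idx_eq ξ (i := fun n => (odometerPathHomeo r y n).val)
      fun n w => by rw [hr]; exact (odometerPathHomeo r y n).isLt
    exact ⟨x, Subtype.ext (funext fun n => Fin.ext (hx n))⟩

/-- In a one-vertex diagram all edges of a level are comparable, whereas in `B` they need a common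
range. Equal positions beyond `n` give equal edges beyond `n`, hence equal ranges at `n`. -/
theorem pathLt_idxPath (hU : ∃ᶠ n in atTop, SrcByIdx fun w => ξ ⟨n, w⟩) {x y : B.PathSpace} :
    PathLt (odometerOrdering r) (idxPath hr ξ x) (idxPath hr ξ y) ↔ PathLt ξ x y := by
  refine exists_congr fun n => ?_
  simp only [idxPath_apply_eq_iff, edgeLt_iff, idx_idxPath]
  constructor
  · rintro ⟨h, -, hlt⟩
    have heq : ∀ k, n < k → x.1 k = y.1 k := fun k hk =>
      eq_of_idx_eq_of_frequently hU (N := n + 1) (fun k hk => h k hk) hk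
    exact ⟨heq, by rw [x.2, y.2, heq (n + 1) n.lt_succ_self], hlt⟩
  · rintro ⟨h, -, hlt⟩
    exact ⟨fun k hk => by rw [h k hk], rfl, hlt⟩

theorem isAdicImage_idxPath (hU : ∃ᶠ n in atTop, SrcByIdx fun w => ξ ⟨n, w⟩)
    {x y : B.PathSpace} :
    IsAdicImage (odometerOrdering r) (idxPath hr ξ x) (idxPath hr ξ y) ↔ IsAdicImage ξ x y := by
  have hb := bijective_idxPath (hr := hr) hU
  simp only [IsAdicImage, hb.surjective.forall, pathLt_idxPath hU, hb.injective.eq_iff]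

theorem idxPath_mem_maxPaths {x : B.PathSpace} :
    idxPath hr ξ x ∈ maxPaths (odometerOrdering r) ↔ x ∈ maxPaths ξ := by
  rw [mem_maxPaths_iff hr, mem_maxPaths_iff fun n w => card_odometerInEdges r ⟨n, w⟩]
  exact Iff.rfl

theorem idxPath_mem_minPaths {x : B.PathSpace} :
    idxPath hr ξ x ∈ minPaths (odometerOrdering r) ↔ x ∈ minPaths ξ := by
  rw [mem_minPaths_iff, mem_minPaths_iff]
  exact Iff.rfl

end Conjugacy

theorem adicConjugateToOdometer_of_frequently_srcByIdx {B : BratteliDiagram.{u}}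
    (hB : IsCantorSet B.PathSpace) {r : ℕ → ℕ}
    (hr : ∀ n (w : B.V (n + 1)), Nat.card {e : B.E n // B.rng n e = w} = r n)
    {ξ : B.EdgeOrdering} (hU : ∃ᶠ n in atTop, SrcByIdx fun w => ξ ⟨n, w⟩) :
    AdicConjugateToOdometer ξ := by
  have : ∀ n, NeZero (r n) := fun n => by
    obtain ⟨w⟩ := B.nonempty_V (n + 1)
    obtain ⟨e, he⟩ := B.rng_surjective n w
    refine ⟨fun h => ?_⟩
    have : Nonempty {e : B.E n // B.rng n e = w} := ⟨⟨e, he⟩⟩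
    exact Nat.card_pos.ne' ((hr n w).trans h)
  obtain ⟨c⟩ := hB
  have : CompactSpace B.PathSpace := c.symm.compactSpace
  have hb := bijective_idxPath (hr := hr) hU
  have hc : Continuous (Equiv.ofBijective _ hb) := continuous_idxPath (hr := hr)
  let F : B.PathSpace ≃ₜ (odometerDiagram r).PathSpace := hc.homeoOfEquivCompactToT2
  have hF : ∀ x, F x = idxPath hr ξ x := fun _ => rfl
  refine ⟨⟨?_, ?_⟩, (F.trans (odometerHomeo r)).trans F.symm, ⟨fun x hx => ?_, fun x hx => ?_⟩,
    odometerDiagram r, odometerOrdering r, odometerHomeo r, F, fun n => ?_, ⟨F.symm.trans c⟩,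
    isAdicHomeo_odometerHomeo, fun x => ?_⟩
  · simpa only [hb.existsUnique_iff, idxPath_mem_maxPaths] using
      (isProper_odometerOrdering (r := r)).1
  · simpa only [hb.existsUnique_iff, idxPath_mem_minPaths] using
      (isProper_odometerOrdering (r := r)).2
  · rw [← isAdicImage_idxPath (hr := hr) hU, ← hF, ← hF]
    simpa using isAdicHomeo_odometerHomeo.1 (F x) (by rwa [hF, idxPath_mem_maxPaths])
  · rw [← idxPath_mem_minPaths (hr := hr), ← hF]
    simpa using isAdicHomeo_odometerHomeo.2 (F x) (by rwa [hF, idxPath_mem_maxPaths])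
  · exact Nat.card_unique (α := Unit)
  · simp

end BratteliDiagram

namespace BratteliDiagram

/-! ### Probability of good levels -/

section Probability

open ProbabilityTheory

variable {B : BratteliDiagram.{u}}

instance (w : B.LowerVertex) :
    IsProbabilityMeasure (uniformOn (Set.univ : Set (B.EdgeOrder w))) :=
  isProbabilityMeasure_uniformOn Set.finite_univ Set.univ_nonempty

/-- The uniform and independent random ordering of the edges between two consecutive levels. -/
noncomputable def levelUniform (B : BratteliDiagram.{u}) (n : ℕ) :
    Measure (∀ w : B.V (n + 1), B.EdgeOrder ⟨n, w⟩) :=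
  Measure.infinitePi fun w => uniformOn (Set.univ : Set (B.EdgeOrder ⟨n, w⟩))

instance (n : ℕ) : IsProbabilityMeasure (B.levelUniform n) := by
  unfold levelUniform; infer_instance

theorem card_edgeOrder (w : B.LowerVertex) :
    Nat.card (B.EdgeOrder w) = (Nat.card (B.InEdges w))! := by
  classical
  have := Fintype.ofFinite (B.InEdges w)
  change Nat.card (B.InEdges w ≃ Fin (Nat.card (B.InEdges w))) = _
  rw [Nat.card_eq_fintype_card, Fintype.card_equiv (Finite.equivFin _), Nat.card_eq_fintype_card]

theorem levelUniform_singleton {n k : ℕ}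
    (hk : ∀ w : B.V (n + 1), Nat.card {e : B.E n // B.rng n e = w} = k)
    (g : ∀ w : B.V (n + 1), B.EdgeOrder ⟨n, w⟩) :
    B.levelUniform n {g} = ((k ! : ℝ≥0∞) ^ Nat.card (B.V (n + 1)))⁻¹ := by
  have := Fintype.ofFinite (B.V (n + 1))
  rw [levelUniform, Measure.infinitePi_singleton_of_fintype]
  have h : ∀ w : B.V (n + 1), uniformOn (Set.univ : Set (B.EdgeOrder ⟨n, w⟩)) {g w} =
      (k ! : ℝ≥0∞)⁻¹ := fun w => by
    have := Fintype.ofFinite (B.EdgeOrder ⟨n, w⟩)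
    rw [uniformOn_univ, Measure.count_singleton, ← Nat.card_eq_fintype_card, card_edgeOrder,
      show Nat.card (B.InEdges ⟨n, w⟩) = k from hk w, one_div]
  rw [Finset.prod_congr rfl fun w _ => h w, Finset.prod_const, Finset.card_univ,
    Nat.card_eq_fintype_card, ENNReal.inv_pow]

/-- If the incidence numbers between two levels do not depend on the range, every linear order on
the edges entering `w₀` is copied to all other vertices in a way compatible with sources. -/
theorem exists_injective_srcByIdx {n k : ℕ} {m : B.V n → ℕ}
    (hm : ∀ (v : B.V n) (w : B.V (n + 1)),
      Nat.card {e : B.E n // B.src n e = v ∧ B.rng n e = w} = m v)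
    (hk : ∀ w : B.V (n + 1), Nat.card {e : B.E n // B.rng n e = w} = k) (w₀ : B.V (n + 1)) :
    ∃ f : B.EdgeOrder ⟨n, w₀⟩ → ∀ w : B.V (n + 1), B.EdgeOrder ⟨n, w⟩,
      Function.Injective f ∧ ∀ o, SrcByIdx (f o) := by
  have hfib : ∀ (w : B.V (n + 1)) (v : B.V n),
      Nat.card {e : B.InEdges ⟨n, w⟩ // B.src n e.1 = v} = m v := fun w v => by
    rw [← hm v w]
    exact Nat.card_congr ((Equiv.subtypeSubtypeEquivSubtypeInter
      (fun e => B.rng n e = w) (fun e => B.src n e = v)).trans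
        (Equiv.subtypeEquivRight fun e => and_comm))
  -- Over each source the fibres at `w₀` and `w` have equal size; gluing bijections of fibres gives
  -- a source-preserving bijection.
  have hτ : ∀ w : B.V (n + 1), ∃ τ : B.InEdges ⟨n, w₀⟩ ≃ B.InEdges ⟨n, w⟩,
      ∀ e, B.src n (τ e).1 = B.src n e.1 := fun w =>
    ⟨Equiv.ofFiberEquiv (f := fun e : B.InEdges ⟨n, w₀⟩ => B.src n e.1)
      (g := fun e : B.InEdges ⟨n, w⟩ => B.src n e.1)
      fun v => (Finite.card_eq.1 ((hfib w₀ v).trans (hfib w v).symm)).some,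
      fun e => Equiv.ofFiberEquiv_map (g := fun e : B.InEdges ⟨n, w⟩ => B.src n e.1) _ e⟩
  choose τ hτ using hτ
  have hcard : ∀ w, Nat.card (B.InEdges ⟨n, w₀⟩) = Nat.card (B.InEdges ⟨n, w⟩) := fun w =>
    (hk w₀).trans (hk w).symm
  refine ⟨fun o w => (τ w).symm.trans (o.toEquiv.trans (finCongr (hcard w))), fun o o' h => ?_,
    fun o => ?_⟩
  -- The component at `w₀` recovers `o`, since `τ w₀` is a bijection, though not necessarily the
  -- identity.
  · refine Equiv.ext fun e => ?_
    have he : finCongr (hcard w₀) (o.toEquiv ((τ w₀).symm (τ w₀ e))) =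
        finCongr (hcard w₀) (o'.toEquiv ((τ w₀).symm (τ w₀ e))) :=
      Equiv.congr_fun (congrFun h w₀) (τ w₀ e)
    rw [Equiv.symm_apply_apply] at he
    exact (finCongr (hcard w₀)).injective he
  · have key : ∀ e : B.E n, ∃ e₀ : B.InEdges ⟨n, w₀⟩, B.src n e = B.src n e₀.1 ∧
        levelIdx (fun w => show B.EdgeOrder ⟨n, w⟩ from
          (τ w).symm.trans (o.toEquiv.trans (finCongr (hcard w)))) e = (o.toEquiv e₀).val :=
      fun e => ⟨(τ _).symm ⟨e, rfl⟩, by rw [← hτ, Equiv.apply_symm_apply], rfl⟩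
    intro e e' h
    obtain ⟨a, ha, ha'⟩ := key e
    obtain ⟨b, hb, hb'⟩ := key e'
    have hab : a = b := o.toEquiv.injective (Fin.ext (ha'.symm.trans (h.trans hb')))
    rw [ha, hb, hab]

/-- The `k !` orders at `w₀` yield as many distinct good level orders, each an atom of mass `1 / (k
!) ^ V`. -/
theorem le_levelUniform_srcByIdx {n k : ℕ} {m : B.V n → ℕ}
    (hm : ∀ (v : B.V n) (w : B.V (n + 1)),
      Nat.card {e : B.E n // B.src n e = v ∧ B.rng n e = w} = m v)
    (hk : ∀ w : B.V (n + 1), Nat.card {e : B.E n // B.rng n e = w} = k) :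
    (k ! : ℝ≥0∞) / (k ! : ℝ≥0∞) ^ Nat.card (B.V (n + 1)) ≤
      B.levelUniform n {g | SrcByIdx g} := by
  obtain ⟨w₀⟩ := B.nonempty_V (n + 1)
  obtain ⟨f, hf, hU⟩ := exists_injective_srcByIdx hm hk w₀
  have := Fintype.ofFinite (B.EdgeOrder ⟨n, w₀⟩)
  calc (k ! : ℝ≥0∞) / (k ! : ℝ≥0∞) ^ Nat.card (B.V (n + 1))
      = ∑ o, B.levelUniform n {f o} := by
        rw [Finset.sum_congr rfl fun o _ => levelUniform_singleton hk (f o), Finset.sum_const,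
          Finset.card_univ, ← Nat.card_eq_fintype_card, card_edgeOrder,
          show Nat.card (B.InEdges ⟨n, w₀⟩) = k from hk w₀, nsmul_eq_mul, div_eq_mul_inv]
    _ = B.levelUniform n (⋃ o, {f o}) := by
        rw [measure_iUnion (fun o o' h => by simpa using hf.ne h)
          fun o => measurableSet_singleton _, tsum_fintype]
    _ ≤ B.levelUniform n {g | SrcByIdx g} :=
        measure_mono (Set.iUnion_subset fun o => Set.singleton_subset_iff.2 (hU o))

theorem uniformOrdering_map_piCurry :
    B.uniformOrdering.map (MeasurableEquiv.piCurry fun n w => B.EdgeOrder ⟨n, w⟩) =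
      Measure.infinitePi fun n => B.levelUniform n :=
  Measure.infinitePi_map_piCurry fun n (w : B.V (n + 1)) =>
    uniformOn (Set.univ : Set (B.EdgeOrder ⟨n, w⟩))

/-- Regrouping the product measure by levels makes goodness at level `n` an event of the `n`-th
factor alone, so these events are independent and the second Borel–Cantelli lemma applies. -/
theorem ae_frequently_srcByIdx
    (h : ∑' n, B.levelUniform n {g | SrcByIdx g} = ∞) :
    ∀ᵐ ξ ∂B.uniformOrdering, ∃ᶠ n in atTop, SrcByIdx fun w => ξ ⟨n, w⟩ := by
  let μ := Measure.infinitePi fun n => B.levelUniform n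
  let s : (n : ℕ) → Set (∀ w : B.V (n + 1), B.EdgeOrder ⟨n, w⟩) := fun n => {g | SrcByIdx g}
  have hs : ∀ n, MeasurableSet (s n) := fun n => (Set.toFinite _).measurableSet
  have hind : iIndepSet (fun n => Function.eval n ⁻¹' s n) μ := by
    rw [iIndepSet_iff_meas_biInter fun n => (measurable_pi_apply n) (hs n)]
    intro t
    exact (iIndepFun_infinitePi (P := fun n => B.levelUniform n) (X := fun n x => x)
      fun n => measurable_id).measure_inter_preimage_eq_mul t fun n _ => hs n
  have hone : μ (limsup (fun n => Function.eval n ⁻¹' s n) atTop) = 1 := by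
    refine measure_limsup_eq_one (fun n => (measurable_pi_apply n) (hs n)) hind ?_
    rw [← h]
    refine tsum_congr fun n => ?_
    exact (measurePreserving_eval_infinitePi (fun n => B.levelUniform n) n).measure_preimage
      (hs n).nullMeasurableSet
  have hae : ∀ᵐ x ∂μ, ∃ᶠ n in atTop, SrcByIdx (x n) := by
    have hmeas : MeasurableSet (limsup (fun n => Function.eval n ⁻¹' s n) atTop :
        Set (∀ n, ∀ w : B.V (n + 1), B.EdgeOrder ⟨n, w⟩)) :=
      MeasurableSet.measurableSet_limsup fun n => (measurable_pi_apply n) (hs n)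
    have := (prob_compl_eq_zero_iff hmeas).2 hone
    filter_upwards [mem_ae_iff.2 this] with x hx
    exact mem_limsup_iff_frequently_mem.1 hx
  rw [show μ = _ from uniformOrdering_map_piCurry.symm] at hae
  exact ae_of_ae_map (MeasurableEquiv.measurable _).aemeasurable hae

end Probability

end BratteliDiagram

/-! ### Bounded case and conclusion -/

theorem ENNReal.tsum_factorial_div_pow_eq_top_of_bounded {r N : ℕ → ℕ} {a b : ℕ}
    (hr : ∀ n, r n ≤ a) (hN : ∀ n, N n ≤ b) :
    ∑' n, ((r n)! : ℝ≥0∞) / ((r n)! : ℝ≥0∞) ^ N n = ∞ := by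
  have hc : ((a ! : ℝ≥0∞) ^ b)⁻¹ ≠ 0 :=
    ENNReal.inv_ne_zero.2 (ENNReal.pow_ne_top (ENNReal.natCast_ne_top _))
  -- Every term is at least the positive constant `1 / (a !) ^ b`.
  rw [eq_top_iff, ← ENNReal.tsum_const_eq_top_of_ne_zero (α := ℕ) hc]
  refine ENNReal.tsum_le_tsum fun n => ?_
  have h₁ : (1 : ℝ≥0∞) ≤ (r n)! := by exact_mod_cast Nat.factorial_pos _
  have h₂ : ((r n)! : ℝ≥0∞) ≤ a ! := by exact_mod_cast Nat.factorial_le (hr n)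
  rw [← one_div]
  refine ENNReal.div_le_div h₁ ?_
  calc ((r n)! : ℝ≥0∞) ^ N n ≤ ((r n)! : ℝ≥0∞) ^ b := pow_le_pow_right₀ h₁ (hN n)
    _ ≤ (a ! : ℝ≥0∞) ^ b := pow_le_pow_left₀ zero_le h₂ b

theorem BratteliDiagram.card_rng_fiber_le {B : BratteliDiagram.{u}} {n C : ℕ} {w : B.V (n + 1)}
    (hm : ∀ v : B.V n, Nat.card {e : B.E n // B.src n e = v ∧ B.rng n e = w} ≤ C) :
    Nat.card {e : B.E n // B.rng n e = w} ≤ Nat.card (B.V n) * C := by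
  have := Fintype.ofFinite (B.V n)
  let F : {e : B.E n // B.rng n e = w} →
      Σ v : B.V n, {e : B.E n // B.src n e = v ∧ B.rng n e = w} :=
    fun e => ⟨B.src n e.1, e.1, rfl, e.2⟩
  have hF : Function.Injective F := fun e e' h =>
    Subtype.ext (congrArg (fun p : Σ v : B.V n,
      {e : B.E n // B.src n e = v ∧ B.rng n e = w} => p.2.1) h)
  calc _ ≤ _ := Nat.card_le_card_of_injective F hF
    _ = ∑ v, Nat.card {e : B.E n // B.src n e = v ∧ B.rng n e = w} := Nat.card_sigma
    _ ≤ ∑ _v : B.V n, C := Finset.sum_le_sum fun v _ => hm v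
    _ = _ := by rw [Finset.sum_const, Finset.card_univ, Nat.card_eq_fintype_card, smul_eq_mul]

theorem mainTheorem9 (B : BratteliDiagram.{u}) (hB : IsCantorSet B.PathSpace)
    (m r : ℕ → ℕ)
    -- `m n` edges between every pair of vertices at levels `n` and `n + 1`
    (hm : ∀ n (v : B.V n) (w : B.V (n + 1)),
      Nat.card {e : B.E n // B.src n e = v ∧ B.rng n e = w} = m n)
    -- `r n` edges in total entering each vertex at level `n + 1`
    (hr : ∀ n (w : B.V (n + 1)), Nat.card {e : B.E n // B.rng n e = w} = r n) :
    ((∑' n, ((r n)! : ℝ≥0∞) / ((r n)! : ℝ≥0∞) ^ Nat.card (B.V (n + 1)) = ∞) →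
      ∀ᵐ ξ ∂B.uniformOrdering,
        (∃ᶠ n in atTop, BratteliDiagram.IsUniformlyOrdered ξ n) ∧
          BratteliDiagram.AdicConjugateToOdometer ξ) ∧
    ((∃ C : ℕ, ∀ n, m n ≤ C ∧ Nat.card (B.V n) ≤ C) →
      ∀ᵐ ξ ∂B.uniformOrdering,
        (∃ᶠ n in atTop, BratteliDiagram.IsUniformlyOrdered ξ n) ∧
          BratteliDiagram.AdicConjugateToOdometer ξ) := by
  have main : (∑' n, ((r n)! : ℝ≥0∞) / ((r n)! : ℝ≥0∞) ^ Nat.card (B.V (n + 1)) = ∞) →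
      ∀ᵐ ξ ∂B.uniformOrdering,
        (∃ᶠ n in atTop, BratteliDiagram.IsUniformlyOrdered ξ n) ∧
          BratteliDiagram.AdicConjugateToOdometer ξ := by
    intro h
    have hsum : ∑' n, B.levelUniform n {g | BratteliDiagram.SrcByIdx g} = ∞ := by
      rw [eq_top_iff, ← h]
      exact ENNReal.tsum_le_tsum fun n =>
        BratteliDiagram.le_levelUniform_srcByIdx (m := fun _ => m n) (hm n) (hr n)
    filter_upwards [BratteliDiagram.ae_frequently_srcByIdx hsum] with ξ hξ
    exact ⟨hξ.mono fun n hn => hn.isUniformlyOrdered (hr n),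
      BratteliDiagram.adicConjugateToOdometer_of_frequently_srcByIdx hB hr hξ⟩
  refine ⟨main, fun ⟨C, hC⟩ => main ?_⟩
  -- The in-degree is at most the number of sources at level `n` times `m n`, hence `C * C`; the
  -- exponent counts vertices at level `n + 1`.
  refine ENNReal.tsum_factorial_div_pow_eq_top_of_bounded (a := C * C) (b := C) (fun n => ?_)
    fun n => (hC (n + 1)).2
  obtain ⟨w⟩ := B.nonempty_V (n + 1)
  rw [← hr n w]
  exact (BratteliDiagram.card_rng_fiber_le fun v => (hm n v w).trans_le (hC n).1).trans
    (Nat.mul_le_mul_right C (hC n).2)
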